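/- Let $k\ge 2$. A $k$-graph is a finite $k$-uniform hypergraph $H$ without repeated edges, with vertex set $V(H)$ and edge set $E(H)$; write $v(H)=|V(H)|$ and $e(H)=|E(H)|$. Write $J\subseteq H$ if $V(J)\subseteq V(H)$ and $E(J)\subseteq E(H)$. Put - $d(H)=e(H)/v(H)$ if $v(H)\ge 1$ and $d(H)=0$ otherwise, and $m(H)=\max\{d(J):J\subseteq H\}$; - $d_1(H)=e(H)/(v(H)-1)$ if $v(H)\ge 2$ and $d_1(H)=0$ otherwise, and $ar(H)=\max\{d_1(J):J\subseteq H\}$; - $\delta(H)$ for the minimum, over the vertices of $H$, of the number of edges containing that vertex ($\delta(H)=0$ if $H$ has no vertices), and $\delta_{\max}(H)=\max\{\delta(J):J\subseteq H\}$; - $\chi(H)$ for the weak chromatic number of $H$, i.e. the least $t$ such that $V(H)$ can be coloured with $t$ colours with no edge of $H$ monochromatic. For $k$-graphs $G,H_1,\dots,H_r$ write $G\to(H_1,\dots,H_r)$ if for every colouring of $E(G)$ with colours $1,\dots,r$ there are $i\in\{1,\dots,r\}$ and a (not necessarily induced) copy of $H_i$ in $G$ all of whose edges have colour $i$. **Lemma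 9.2.** Let $G,H_1,\dots,H_r$ be $k$-graphs, where each $H_i$ has at least one edge. Then $G\not\to(H_1,\dots,H_r)$ if any of the following holds: (i) there exists $\varepsilon>0$ such that $ar(G)\le\sum_{i=1}^r\lfloor ar(H_i)-\varepsilon\rfloor$; (ii) there exists $\varepsilon>0$ such that $m(G)\le\sum_{i=1}^r\lfloor m(H_i)-\varepsilon\rfloor$; (iii) $\delta_{\max}(G)\le\sum_{i=1}^r(\delta(H_i)-1)$; (iv) $r\ge 2$, $m(G)<\delta_{\max}(H_1)$ and $\chi(H_2)\ge k+1$. -/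

import Mathlib

/-- A `k`-graph: a finite `k`-uniform hypergraph (without repeated edges). The vertex set is a
finite subset of the ambient type `α`, and may contain isolated vertices. -/
structure KGraph (k : ℕ) (α : Type*) extends Hypergraph α where
  finite_vertexSet : vertexSet.Finite
  uniform : ∀ e ∈ edgeSet, e.ncard = k

namespace KGraph

/-- `J ⊆ H`: every vertex of `J` is a vertex of `H` and every edge of `J` is an edge of `H`. -/
def IsSubgraph {k : ℕ} {α : Type*} (J H : KGraph k α) : Prop :=
  J.vertexSet ⊆ H.vertexSet ∧ J.edgeSet ⊆ H.edgeSet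

/-- The number of vertices. -/
noncomputable def numVerts {k : ℕ} {α : Type*} (H : KGraph k α) : ℕ := H.vertexSet.ncard

/-- The number of edges. -/
noncomputable def numEdges {k : ℕ} {α : Type*} (H : KGraph k α) : ℕ := H.edgeSet.ncard

/-- `d(H) = e(H) / v(H)` if `v(H) ≥ 1`, and `0` otherwise. -/
noncomputable def d {k : ℕ} {α : Type*} (H : KGraph k α) : ℝ :=
  if 1 ≤ H.numVerts then (H.numEdges : ℝ) / (H.numVerts : ℝ) else 0

/-- `d₁(H) = e(H) / (v(H) - 1)` if `v(H) ≥ 2`, and `0` otherwise. -/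
noncomputable def d₁ {k : ℕ} {α : Type*} (H : KGraph k α) : ℝ :=
  if 2 ≤ H.numVerts then (H.numEdges : ℝ) / ((H.numVerts : ℝ) - 1) else 0

/-- The `m`-density `m(H) = max {d(J) : J ⊆ H}`. -/
noncomputable def mDensity {k : ℕ} {α : Type*} (H : KGraph k α) : ℝ :=
  sSup {x : ℝ | ∃ J : KGraph k α, J.IsSubgraph H ∧ x = J.d}

/-- The arboricity `ar(H) = max {d₁(J) : J ⊆ H}`. -/
noncomputable def arboricity {k : ℕ} {α : Type*} (H : KGraph k α) : ℝ :=
  sSup {x : ℝ | ∃ J : KGraph k α, J.IsSubgraph H ∧ x = J.d₁}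

/-- The degree of `v`: the number of edges containing `v`. -/
noncomputable def degree {k : ℕ} {α : Type*} (H : KGraph k α) (v : α) : ℕ :=
  {e : Set α | e ∈ H.edgeSet ∧ v ∈ e}.ncard

/-- The minimum degree `δ(H)` over the vertices of `H` (`0` if there are no vertices). -/
noncomputable def minDegree {k : ℕ} {α : Type*} (H : KGraph k α) : ℕ :=
  sInf (H.degree '' H.vertexSet)

/-- `δ_max(H) = max {δ(J) : J ⊆ H}`. -/
noncomputable def maxMinDegree {k : ℕ} {α : Type*} (H : KGraph k α) : ℕ :=
  sSup {n : ℕ | ∃ J : KGraph k α, J.IsSubgraph H ∧ n = J.minDegree}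

/-- The vertices of `H` can be coloured with `t` colours so that no edge is monochromatic. -/
def WeaklyColorable {k : ℕ} {α : Type*} (H : KGraph k α) (t : ℕ) : Prop :=
  ∃ c : H.vertexSet → Fin t, ∀ e ∈ H.edgeSet,
    ∃ u v : H.vertexSet, (u : α) ∈ e ∧ (v : α) ∈ e ∧ c u ≠ c v

/-- The weak chromatic number: the least `t` such that `H` is weakly `t`-colourable
(such a `t` exists as soon as `k ≥ 2`). -/
noncomputable def weakChromaticNumber {k : ℕ} {α : Type*} (H : KGraph k α) : ℕ :=
  sInf {t : ℕ | H.WeaklyColorable t}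

/-- For an edge colouring `c` of `G`, the spanning subgraph of `G` whose edges are those
of colour `i`. -/
def colorClass {k r : ℕ} {α : Type*} (G : KGraph k α) (c : G.edgeSet → Fin r) (i : Fin r) :
    KGraph k α where
  vertexSet := G.vertexSet
  edgeSet := {e : Set α | ∃ he : e ∈ G.edgeSet, c ⟨e, he⟩ = i}
  subset_vertexSet_of_mem_edgeSet' := fun _ h => G.subset_vertexSet_of_mem_edgeSet' h.1
  finite_vertexSet := G.finite_vertexSet
  uniform := fun e h => G.uniform e h.1

/-- `G` contains a (not necessarily induced) copy of `H`: there is an injection `f` from the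
vertices of `H` to the vertices of `G` which maps every edge of `H` to an edge of `G`. -/
def ContainsCopy {k : ℕ} {α β : Type*} (G : KGraph k α) (H : KGraph k β) : Prop :=
  ∃ f : H.vertexSet → α, Function.Injective f ∧ (∀ v, f v ∈ G.vertexSet) ∧
    ∀ e ∈ H.edgeSet, f '' {v : H.vertexSet | (v : β) ∈ e} ∈ G.edgeSet

/-- `G → (H₁, …, H_r)`: for every colouring of the edges of `G` with `r` colours there are a
colour `i` and a copy of `H_i` in `G` all of whose edges have colour `i`. -/
def Arrows {k r : ℕ} {α : Type*} {β : Fin r → Type*} (G : KGraph k α)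
    (H : (i : Fin r) → KGraph k (β i)) : Prop :=
  ∀ c : G.edgeSet → Fin r, ∃ i : Fin r, (G.colorClass c i).ContainsCopy (H i)

theorem finite_edgeSet {k : ℕ} {α : Type*} (H : KGraph k α) : H.edgeSet.Finite :=
  H.finite_vertexSet.powerset.subset fun _ he => H.subset_vertexSet_of_mem_edgeSet' he

/-- A `k`-graph has only finitely many subgraphs, so that the maxima above are attained. -/
theorem finite_subgraphs {k : ℕ} {α : Type*} (H : KGraph k α) :
    {J : KGraph k α | J.IsSubgraph H}.Finite := by
  have hfin := H.finite_vertexSet.powerset.prod H.finite_edgeSet.powerset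
  refine Set.Finite.of_finite_image (f := fun J : KGraph k α => (J.vertexSet, J.edgeSet))
    (hfin.subset ?_) ?_
  · rintro _ ⟨J, hJ, rfl⟩
    exact ⟨hJ.1, hJ.2⟩
  · rintro ⟨⟨V, E, h⟩, hf, hu⟩ _ ⟨⟨V', E', h'⟩, hf', hu'⟩ _ hEq
    simp only [Prod.mk.injEq] at hEq
    obtain ⟨rfl, rfl⟩ := hEq
    rfl

theorem isGreatest_mDensity {k : ℕ} {α : Type*} (H : KGraph k α) :
    IsGreatest {x : ℝ | ∃ J : KGraph k α, J.IsSubgraph H ∧ x = J.d} H.mDensity := by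
  have hfin : {x : ℝ | ∃ J : KGraph k α, J.IsSubgraph H ∧ x = J.d}.Finite :=
    (H.finite_subgraphs.image d).subset fun x ⟨J, hJ, hx⟩ => ⟨J, hJ, hx.symm⟩
  have hne : {x : ℝ | ∃ J : KGraph k α, J.IsSubgraph H ∧ x = J.d}.Nonempty :=
    ⟨_, H, ⟨subset_rfl, subset_rfl⟩, rfl⟩
  exact ⟨hne.csSup_mem hfin, fun _ hx => le_csSup hfin.bddAbove hx⟩

theorem isGreatest_arboricity {k : ℕ} {α : Type*} (H : KGraph k α) :
    IsGreatest {x : ℝ | ∃ J : KGraph k α, J.IsSubgraph H ∧ x = J.d₁} H.arboricity := by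
  have hfin : {x : ℝ | ∃ J : KGraph k α, J.IsSubgraph H ∧ x = J.d₁}.Finite :=
    (H.finite_subgraphs.image d₁).subset fun x ⟨J, hJ, hx⟩ => ⟨J, hJ, hx.symm⟩
  have hne : {x : ℝ | ∃ J : KGraph k α, J.IsSubgraph H ∧ x = J.d₁}.Nonempty :=
    ⟨_, H, ⟨subset_rfl, subset_rfl⟩, rfl⟩
  exact ⟨hne.csSup_mem hfin, fun _ hx => le_csSup hfin.bddAbove hx⟩

theorem isGreatest_maxMinDegree {k : ℕ} {α : Type*} (H : KGraph k α) :
    IsGreatest {n : ℕ | ∃ J : KGraph k α, J.IsSubgraph H ∧ n = J.minDegree} H.maxMinDegree := by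
  have hfin : {n : ℕ | ∃ J : KGraph k α, J.IsSubgraph H ∧ n = J.minDegree}.Finite :=
    (H.finite_subgraphs.image minDegree).subset fun x ⟨J, hJ, hx⟩ => ⟨J, hJ, hx.symm⟩
  have hne : {n : ℕ | ∃ J : KGraph k α, J.IsSubgraph H ∧ n = J.minDegree}.Nonempty :=
    ⟨_, H, ⟨subset_rfl, subset_rfl⟩, rfl⟩
  exact ⟨hne.csSup_mem hfin, fun _ hx => le_csSup hfin.bddAbove hx⟩

/-- For `k ≥ 2` some number of colours suffices, so the weak chromatic number is a minimum. -/
theorem weaklyColorable_weakChromaticNumber {k : ℕ} (hk : 2 ≤ k) {α : Type*} (H : KGraph k α) :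
    H.WeaklyColorable H.weakChromaticNumber := by
  have hne : {t : ℕ | H.WeaklyColorable t}.Nonempty := by
    have := H.finite_vertexSet.to_subtype
    refine ⟨Nat.card H.vertexSet, Finite.equivFin H.vertexSet, fun e he => ?_⟩
    have hsub := H.subset_vertexSet_of_mem_edgeSet' he
    obtain ⟨u, v, hu, hv, huv⟩ := (Set.one_lt_ncard_iff (H.finite_vertexSet.subset hsub)).1
      (by rw [H.uniform e he]; omega)
    refine ⟨⟨u, hsub hu⟩, ⟨v, hsub hv⟩, hu, hv, fun h => huv ?_⟩
    exact congrArg Subtype.val ((Finite.equivFin H.vertexSet).injective h)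
  exact Nat.sInf_mem hne

end KGraph

/-! Each of `arboricity`, `mDensity` and `maxMinDegree` is monotone under containing a copy, and
weak colourability passes to copies. So it suffices to colour the edges of `G` so that no class `i`
has a large enough parameter to contain `H i`.

For (i)-(iii) the parameters split: if the parameter of `G` is at most `∑ a i`, then some edge
colouring keeps class `i` at most `a i`. Colour with `Σ i, Fin (a i)` so that every class is
elementary, then forget the second coordinate. For arboricity the elementary classes are hypergraph
forests: hyperedges shrink to pairs by uncrossing, and Horn–Rado is applied to the vectors `e_u -
e_v` over `ℚ`. For `m` the classes come from Hall's theorem, and for `δ_max` from a greedy colouring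
along a degeneracy order.

For (iv), with `D = δ_max(H₁)`, the bound `m(G) < D` makes every vertex set contain a vertex of
degree less than `k * D`. Greedily colouring vertices with `k` colours leaves the monochromatic
edges `(D - 1)`-degenerate. These get the first colour; the remaining edges are weakly
`k`-colourable and get the second. -/

/-! ### Partition into independent families -/

open Finset in
/-- If `w h` lies in the span of an independent family `T`, it lies in the span of those members
which can be exchanged for `h`. -/
theorem LinearIndepOn.mem_span_exchangeable {K V ι : Type*} [Field K] [AddCommGroup V] [Module K V]
    {w : ι → V} {T : Set ι} {x : V} (hT : LinearIndepOn K w T)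
    (hx : x ∈ Submodule.span K (w '' T)) :
    x ∈ Submodule.span K (w '' {f ∈ T | x ∉ Submodule.span K (w '' (T \ {f}))}) := by
  obtain ⟨l, hl, rfl⟩ := (Finsupp.mem_span_image_iff_linearCombination K).1 hx
  refine (Finsupp.mem_span_image_iff_linearCombination K).2 ⟨l, ?_, rfl⟩
  rw [Finsupp.mem_supported] at hl ⊢
  intro f hf
  -- The expansion over `T` is unique, so a member with nonzero coefficient cannot be avoided.
  refine ⟨hl hf, fun hmem => ?_⟩
  obtain ⟨l', hl', h⟩ := (Finsupp.mem_span_image_iff_linearCombination K).1 hmem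
  have hl'T : l' ∈ Finsupp.supported K K T := Finsupp.supported_mono Set.sdiff_subset hl'
  have := linearIndepOn_iff.1 hT (l' - l) (Submodule.sub_mem _ hl'T hl) (by simp [h])
  have hEq : l' = l := sub_eq_zero.1 this
  subst hEq
  exact ((Finsupp.mem_supported _ _).1 hl' hf).2 rfl

open Finset in
/-- The Horn–Rado theorem: a finite family of vectors in which every subfamily `F` has at most
`|κ| * rank F` members splits into `|κ|` independent families. -/
theorem exists_coloring_linearIndepOn (K : Type*) {V ι κ : Type*} [Field K] [AddCommGroup V]
    [Module K V] [Fintype ι] [Fintype κ] (w : ι → V)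
    (hw : ∀ F : Finset ι,
      #F ≤ Fintype.card κ * Module.finrank K (Submodule.span K (w '' (F : Set ι)))) :
    ∃ c : ι → κ, ∀ j, LinearIndepOn K w {x | c x = j} := by
  classical
  suffices H : ∀ S : Finset ι, ∃ c : ι → κ, ∀ j, LinearIndepOn K w {x | x ∈ S ∧ c x = j} by
    simpa using H univ
  intro S
  induction S using Finset.induction_on with
  | empty =>
    cases isEmpty_or_nonempty ι with
    | inl h => exact ⟨fun x => h.elim x, by simp⟩
    | inr h =>
      obtain ⟨x⟩ := h
      have h1 := hw {x}
      have : 0 < Fintype.card κ := by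
        by_contra h0
        simp [Nat.eq_zero_of_not_pos h0] at h1
      obtain ⟨j⟩ := Fintype.card_pos_iff.1 this
      exact ⟨fun _ => j, by simp⟩
  | insert e s he ih =>
    obtain ⟨c₀, hc₀⟩ := ih
    set S := insert e s with hS
    -- In a state `(h, c)` only `h` is left uncoloured in `S`. A step gives `h` colour `j` and
    -- uncolours some `f` exchangeable for it.
    let T : ι × (ι → κ) → κ → Set ι := fun σ j => {x | x ∈ S ∧ x ≠ σ.1 ∧ σ.2 x = j}
    let step : ι × (ι → κ) → ι × (ι → κ) → Prop := fun σ τ =>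
      ∃ j, τ.1 ∈ T σ j ∧ w σ.1 ∉ Submodule.span K (w '' (T σ j \ {τ.1})) ∧
        τ.2 = Function.update σ.2 σ.1 j
    let R := Relation.ReflTransGen step (e, c₀)
    have hT0 : ∀ j, LinearIndepOn K w (T (e, c₀) j) := fun j =>
      (hc₀ j).mono fun x hx => ⟨(mem_insert.1 hx.1).resolve_left hx.2.1, hx.2.2⟩
    by_contra hno
    push Not at hno
    have hTne : ∀ {σ : ι × (ι → κ)} {τ : ι × (ι → κ)} {j : κ}, τ.1 ∈ T σ j →
        τ.2 = Function.update σ.2 σ.1 j → ∀ i, i ≠ j → T τ i = T σ i := by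
      rintro ⟨h, c⟩ ⟨f, c'⟩ j hf hc' i hij
      simp only at hc'
      subst hc'
      obtain ⟨hfS, hfh, hfc⟩ := hf
      simp only at hfh hfc hfS
      ext x
      simp only [T, Set.mem_ofPred_eq, Function.update_apply]
      grind
    have hTeq : ∀ {σ : ι × (ι → κ)} {τ : ι × (ι → κ)} {j : κ}, τ.1 ∈ T σ j →
        τ.2 = Function.update σ.2 σ.1 j → T τ j ⊆ insert σ.1 (T σ j \ {τ.1}) := by
      rintro ⟨h, c⟩ ⟨f, c'⟩ j hf hc' x
      simp only at hc'
      subst hc'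
      simp only [T, Set.mem_ofPred_eq, Function.update_apply, Set.mem_insert_iff, Set.mem_sdiff,
        Set.mem_singleton_iff]
      grind
    have hind : ∀ σ, R σ → σ.1 ∈ S ∧ ∀ j, LinearIndepOn K w (T σ j) := by
      intro σ hσ
      induction hσ with
      | refl => exact ⟨by simp [hS], hT0⟩
      | tail _ hst ih =>
        obtain ⟨j, h1, h2, h3⟩ := hst
        refine ⟨h1.1, fun i => ?_⟩
        by_cases hij : i = j
        · subst hij
          exact (((ih.2 i).mono Set.sdiff_subset).insert h2).mono (hTeq h1 h3)
        · rw [hTne h1 h3 i hij]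
          exact ih.2 i
    have hspan : ∀ σ, R σ → ∀ j, w σ.1 ∈ Submodule.span K (w '' T σ j) := by
      intro σ hσ j
      by_contra hn
      obtain ⟨i, hi⟩ := hno (Function.update σ.2 σ.1 j)
      apply hi
      by_cases hij : i = j
      · subst hij
        refine (((hind σ hσ).2 i).insert hn).mono ?_
        intro x
        simp only [T, Set.mem_ofPred_eq, Function.update_apply, Set.mem_insert_iff]
        grind
      · refine ((hind σ hσ).2 i).mono ?_
        intro x
        simp only [T, Set.mem_ofPred_eq, Function.update_apply]
        grind
    -- The elements that can become uncoloured. This set will violate the rank bound.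
    let E₀ : Set ι := {h | ∃ c, R (h, c)}
    have hspan' : ∀ σ, R σ → ∀ j, w σ.1 ∈ Submodule.span K (w '' (T σ j ∩ E₀)) := by
      intro σ hσ j
      refine Submodule.span_mono (Set.image_mono ?_)
        (((hind σ hσ).2 j).mem_span_exchangeable (hspan σ hσ j))
      rintro f ⟨hf, hne⟩
      exact ⟨hf, _, hσ.tail ⟨j, hf, hne, rfl⟩⟩
    -- A step adds to one class only the old uncoloured element, already in the span of that class
    -- within `E₀`; so these spans never grow.
    have hmono : ∀ σ, R σ → ∀ j, Submodule.span K (w '' (T σ j ∩ E₀)) ≤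
        Submodule.span K (w '' (T (e, c₀) j ∩ E₀)) := by
      intro σ hσ j
      induction hσ with
      | refl => exact le_rfl
      | @tail σ τ hσ hst ih =>
        refine le_trans ?_ ih
        obtain ⟨i, h1, h2, h3⟩ := hst
        by_cases hij : j = i
        · subst hij
          rw [Submodule.span_le]
          rintro _ ⟨x, ⟨hxT, hxE⟩, rfl⟩
          rcases hTeq h1 h3 hxT with rfl | hx
          · exact hspan' σ hσ j
          · exact Submodule.subset_span ⟨x, ⟨hx.1, hxE⟩, rfl⟩
        · rw [hTne h1 h3 j hij]
    have hrank : ∀ j, Module.finrank K (Submodule.span K (w '' E₀)) ≤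
        #{x | x ∈ T (e, c₀) j ∩ E₀} := by
      intro j
      have hle : Submodule.span K (w '' E₀) ≤
          Submodule.span K (w '' (T (e, c₀) j ∩ E₀)) := by
        rw [Submodule.span_le]
        rintro _ ⟨h, ⟨c, hc⟩, rfl⟩
        exact hmono _ hc j (hspan' _ hc j)
      have : Module.Finite K (Submodule.span K (w '' (T (e, c₀) j ∩ E₀))) :=
        Module.Finite.span_of_finite K ((Set.toFinite _).image w)
      refine (Submodule.finrank_mono hle).trans ?_
      have h2 := finrank_span_finset_le_card (R := K)
        (({x | x ∈ T (e, c₀) j ∩ E₀} : Finset ι).image w)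
      refine le_trans (le_of_eq ?_) (h2.trans card_image_le)
      rw [coe_image, coe_filter_univ]
      rfl
    have hcard := hw {x | x ∈ E₀}
    -- The initial classes partition `E₀` minus `e`, and each has at least `rank E₀` members there:
    -- one element too few.
    have hsum : ∑ j : κ, #{x | x ∈ T (e, c₀) j ∩ E₀} = #{x | x ∈ E₀ ∧ x ≠ e} := by
      rw [card_eq_sum_card_fiberwise (f := c₀) (t := univ) (by simp)]
      refine sum_congr rfl fun j _ => congrArg card ?_
      ext x
      simp only [T, mem_filter, mem_univ, true_and, Set.mem_inter_iff, Set.mem_ofPred_eq]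
      constructor
      · rintro ⟨⟨h1, h2, h3⟩, h4⟩
        exact ⟨⟨h4, h2⟩, h3⟩
      · rintro ⟨⟨h4, h2⟩, h3⟩
        obtain ⟨c, hc⟩ := h4
        exact ⟨⟨(hind _ hc).1, h2, h3⟩, c, hc⟩
    have hlt : #{x | x ∈ E₀ ∧ x ≠ e} < #{x | x ∈ E₀} := by
      refine card_lt_card ⟨fun x => by simp +contextual, fun h => ?_⟩
      have heE : e ∈ E₀ := ⟨c₀, .refl⟩
      simpa using h (by simpa using heE : e ∈ ({x | x ∈ E₀} : Finset ι))
    have hge : Fintype.card κ * Module.finrank K (Submodule.span K (w '' E₀)) ≤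
        ∑ j : κ, #{x | x ∈ T (e, c₀) j ∩ E₀} := by
      simpa using sum_le_sum fun j (_ : j ∈ (univ : Finset κ)) => hrank j
    have hcoe : ((({x | x ∈ E₀} : Finset ι)) : Set ι) = E₀ := by ext; simp
    rw [hcoe] at hcard
    omega

/-! ### Hypergraph forests -/

open Finset in
/-- Edges of a sparse family can be shrunk to pairs without destroying sparsity. -/
theorem exists_sparse_pairs {ι α : Type*} [Fintype ι] [DecidableEq α] (a : ℕ) (p : ι → Finset α)
    (hp : ∀ F : Finset ι, F.Nonempty → #F + a ≤ a * #(F.biUnion p)) :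
    ∃ q : ι → Finset α, (∀ i, q i ⊆ p i ∧ #(q i) = 2) ∧
      ∀ F : Finset ι, F.Nonempty → #F + a ≤ a * #(F.biUnion q) := by
  classical
  induction hn : ∑ i, #(p i) using Nat.strong_induction_on generalizing p with
  | _ n ih =>
    have h2 : ∀ i, 2 ≤ #(p i) := by
      intro i
      have h := hp {i} (by simp)
      simp only [card_singleton, singleton_biUnion] at h
      by_contra hlt
      have : a * #(p i) ≤ a * 1 := Nat.mul_le_mul_left _ (by omega)
      omega
    by_cases hall : ∀ i, #(p i) = 2
    · exact ⟨p, fun i => ⟨subset_rfl, hall i⟩, hp⟩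
    push Not at hall
    obtain ⟨e, he⟩ := hall
    have he3 : 2 < #(p e) := lt_of_le_of_ne (h2 e) (Ne.symm he)
    obtain ⟨u, v, z, hu, hv, hz, huv, huz, hvz⟩ := two_lt_card_iff.1 he3
    have key : ∀ x ∈ p e, (∀ F : Finset ι, F.Nonempty →
        #F + a ≤ a * #(F.biUnion (Function.update p e ((p e).erase x)))) →
        ∃ q : ι → Finset α, (∀ i, q i ⊆ p i ∧ #(q i) = 2) ∧
          ∀ F : Finset ι, F.Nonempty → #F + a ≤ a * #(F.biUnion q) := by
      intro x hx h
      have hsub : ∀ i, Function.update p e ((p e).erase x) i ⊆ p i := by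
        intro i
        by_cases hi : i = e
        · subst hi
          simpa using erase_subset _ _
        · simp [hi]
      have hlt : ∑ i, #(Function.update p e ((p e).erase x) i) < n := by
        rw [← hn]
        refine sum_lt_sum (fun i _ => card_le_card (hsub i)) ⟨e, mem_univ _, ?_⟩
        simpa using card_erase_lt_of_mem hx
      obtain ⟨q, hq, hq'⟩ := ih _ hlt _ h rfl
      exact ⟨q, fun i => ⟨(hq i).1.trans (hsub i), (hq i).2⟩, hq'⟩
    have bad : ∀ x, ¬ (∀ F : Finset ι, F.Nonempty →
        #F + a ≤ a * #(F.biUnion (Function.update p e ((p e).erase x)))) →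
        ∃ X : Finset ι, e ∉ X ∧ a * #(X.biUnion p ∪ (p e).erase x) ≤ #X + a := by
      intro x h
      push Not at h
      obtain ⟨F, hF, hlt⟩ := h
      have hup : ∀ X : Finset ι, e ∉ X →
          X.biUnion (Function.update p e ((p e).erase x)) = X.biUnion p := by
        intro X hX
        refine biUnion_congr rfl fun i hi => ?_
        rw [Function.update_of_ne (by rintro rfl; exact hX hi)]
      have heF : e ∈ F := by
        by_contra heF
        rw [hup F heF] at hlt
        exact absurd (hp F hF) (not_le.2 hlt)
      refine ⟨F.erase e, notMem_erase _ _, ?_⟩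
      have h1 := insert_erase heF
      rw [← h1, biUnion_insert, Function.update_self, hup _ (notMem_erase _ _),
        card_insert_of_notMem (notMem_erase _ _), union_comm] at hlt
      omega
    by_cases gu : ∀ F : Finset ι, F.Nonempty →
        #F + a ≤ a * #(F.biUnion (Function.update p e ((p e).erase u)))
    · exact key u hu gu
    by_cases gv : ∀ F : Finset ι, F.Nonempty →
        #F + a ≤ a * #(F.biUnion (Function.update p e ((p e).erase v)))
    · exact key v hv gv
    -- Uncrossing: if neither `u` nor `v` can be deleted from `p e`, add the two tight inequalities.
    -- Sparsity of `insert e (X ∪ Y)` and of `X ∩ Y` exceeds the sum by one. The third vertex `z`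
    -- lies in `A ∩ B` and covers the case `X ∩ Y = ∅`.
    exfalso
    obtain ⟨X, heX, hX⟩ := bad u gu
    obtain ⟨Y, heY, hY⟩ := bad v gv
    set A := X.biUnion p ∪ (p e).erase u with hA
    set B := Y.biUnion p ∪ (p e).erase v with hB
    have hun : (insert e (X ∪ Y)).biUnion p = A ∪ B := by
      ext t
      simp only [hA, hB, mem_biUnion, mem_union, mem_insert, mem_erase]
      grind
    have h1 := hp (insert e (X ∪ Y)) (by simp)
    rw [hun, card_insert_of_notMem (by simp [heX, heY])] at h1
    have h3 : #(X ∩ Y) + a ≤ a * #(A ∩ B) := by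
      rcases (X ∩ Y).eq_empty_or_nonempty with h0 | h0
      · have : 0 < #(A ∩ B) := card_pos.2 ⟨z, by simp [hA, hB, hz, huz.symm, hvz.symm]⟩
        rw [h0, card_empty, zero_add]
        exact Nat.le_mul_of_pos_right _ this
      · refine (hp _ h0).trans (Nat.mul_le_mul_left _ (card_le_card ?_))
        intro t
        simp only [hA, hB, mem_biUnion, mem_union, mem_inter]
        grind
    have h4 := card_union_add_card_inter A B
    have h5 := card_union_add_card_inter X Y
    have h6 : a * #(A ∪ B) + a * #(A ∩ B) = a * #A + a * #B := by
      rw [← mul_add, h4, mul_add]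
    omega

open Finset in
/-- A sparse multigraph has large rank in the graphic matroid. -/
theorem card_le_mul_finrank_of_sparse {ι α : Type*} [DecidableEq α] (a : ℕ) (u v : ι → α)
    (hp : ∀ F : Finset ι, F.Nonempty → #F + a ≤ a * #(F.biUnion fun i => {u i, v i}))
    (F : Finset ι) :
    #F ≤ a * Module.finrank ℚ (Submodule.span ℚ
      ((fun i => Finsupp.single (u i) (1 : ℚ) - Finsupp.single (v i) 1) '' (F : Set ι))) := by
  classical
  set w : ι → α →₀ ℚ := fun i => Finsupp.single (u i) (1 : ℚ) - Finsupp.single (v i) 1 with hw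
  set N := Submodule.span ℚ (w '' (F : Set ι)) with hN
  -- The classes act as connected components of `F`; each non-representative in `U` contributes one
  -- dimension.
  let s : Setoid α :=
    { r := fun x y => Finsupp.single x (1 : ℚ) - Finsupp.single y 1 ∈ N
      iseqv :=
        ⟨fun x => by simp, fun {x y} h => by simpa using N.neg_mem h,
          fun {x y z} h1 h2 => by simpa using N.add_mem h1 h2⟩ }
  let rep : α → α := fun x => (Quotient.mk s x).out
  have hrep : ∀ x, Finsupp.single x (1 : ℚ) - Finsupp.single (rep x) 1 ∈ N := fun x =>
    Setoid.symm (Quotient.mk_out (s := s) x)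
  have hrepeq : ∀ x y, Finsupp.single x (1 : ℚ) - Finsupp.single y 1 ∈ N → rep x = rep y :=
    fun x y h => congrArg Quotient.out (Quotient.sound (s := s) h)
  have hidem : ∀ x, rep (rep x) = rep x := fun x => (hrepeq _ _ (hrep x)).symm
  set U := F.biUnion fun i => ({u i, v i} : Finset α) with hU
  set D := {x ∈ U | rep x ≠ x} with hD
  have hDN : #D ≤ Module.finrank ℚ N := by
    have : Module.Finite ℚ N := Module.Finite.span_of_finite ℚ (F.finite_toSet.image w)
    let z : D → N := fun x => ⟨_, hrep x⟩
    have hz : LinearIndependent ℚ z := by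
      rw [Fintype.linearIndependent_iff]
      intro g hg y
      have h0 := congrArg (fun t : N => (t : α →₀ ℚ) (y : α)) hg
      have hy := (mem_filter.1 y.2).2
      -- No representative equals `y`, so coordinate `y` isolates the coefficient of `y`.
      have hne : ∀ x, rep x ≠ y := fun x h => hy (by rw [← h, hidem])
      simp only [z, Submodule.coe_sum, Submodule.coe_smul, Finsupp.coe_finsetSum,
        Finset.sum_apply, Finsupp.smul_apply, Finsupp.sub_apply, Finsupp.single_apply, hne,
        if_false, sub_zero, smul_eq_mul, mul_ite, mul_one, mul_zero, Subtype.coe_inj,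
        ZeroMemClass.coe_zero, Finsupp.coe_zero, Pi.zero_apply] at h0
      simpa using h0
    simpa using hz.fintype_card_le_finrank
  refine le_trans ?_ (Nat.mul_le_mul_left a hDN)
  have huv : ∀ i ∈ F, rep (u i) = rep (v i) := fun i hi =>
    hrepeq _ _ (Submodule.subset_span ⟨i, hi, rfl⟩)
  rw [card_eq_sum_card_image (fun i => rep (u i)) F]
  have hfib : ∀ c ∈ F.image (fun i => rep (u i)),
      #{i ∈ F | rep (u i) = c} ≤ a * #{x ∈ D | rep x = c} := by
    intro c hc
    obtain ⟨i, hi, rfl⟩ := mem_image.1 hc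
    have h1 := hp {j ∈ F | rep (u j) = rep (u i)} ⟨i, by simp [hi]⟩
    have h2 : ({j ∈ F | rep (u j) = rep (u i)}.biUnion fun i => ({u i, v i} : Finset α)) ⊆
        insert (rep (u i)) {x ∈ D | rep x = rep (u i)} := by
      intro x
      simp only [hD, hU, mem_biUnion, mem_filter, mem_insert, mem_singleton]
      rintro ⟨j, ⟨hj, hji⟩, hx⟩
      have hx' : rep x = rep (u i) := by
        rcases hx with rfl | rfl
        · exact hji
        · rw [← huv j hj, hji]
      by_cases hxe : x = rep (u i)
      · exact Or.inl hxe
      · exact Or.inr ⟨⟨⟨j, hj, hx⟩, fun h => hxe (by rw [← h, hx'])⟩, hx'⟩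
    have h3 := Nat.mul_le_mul_left a ((card_le_card h2).trans (card_insert_le _ _))
    rw [mul_add] at h3
    omega
  refine (sum_le_sum hfib).trans ?_
  rw [← mul_sum]
  refine Nat.mul_le_mul_left a ?_
  rw [sum_card_fiberwise_eq_card_filter]
  exact card_filter_le _ _

open Finset in
/-- Nash-Williams' arboricity theorem for hypergraphs. -/
theorem exists_coloring_forests {ι α κ : Type*} [Fintype ι] [Fintype κ] [DecidableEq α]
    (p : ι → Finset α)
    (hp : ∀ F : Finset ι, F.Nonempty →
      #F + Fintype.card κ ≤ Fintype.card κ * #(F.biUnion p)) :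
    ∃ c : ι → κ, ∀ j, ∀ F : Finset ι, F.Nonempty → (∀ i ∈ F, c i = j) →
      #F + 1 ≤ #(F.biUnion p) := by
  classical
  obtain ⟨q, hq, hqs⟩ := exists_sparse_pairs _ p hp
  choose u v huv hquv using fun i => card_eq_two.1 (hq i).2
  obtain rfl : q = fun i => {u i, v i} := funext hquv
  obtain ⟨c, hc⟩ := exists_coloring_linearIndepOn (κ := κ) ℚ _
    (card_le_mul_finrank_of_sparse _ u v hqs)
  refine ⟨c, fun j F hF hFj => ?_⟩
  set w : ι → α →₀ ℚ := fun i => Finsupp.single (u i) (1 : ℚ) - Finsupp.single (v i) 1 with hw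
  set U := F.biUnion fun i => ({u i, v i} : Finset α) with hU
  refine le_trans ?_ (card_le_card (biUnion_mono fun i _ => (hq i).1 : U ⊆ F.biUnion p))
  obtain ⟨i₀, hi₀⟩ := hF
  have hmem : ∀ i ∈ F, u i ∈ U ∧ v i ∈ U := fun i hi =>
    ⟨mem_biUnion.2 ⟨i, hi, by simp⟩, mem_biUnion.2 ⟨i, hi, by simp⟩⟩
  have hx₀ := (hmem i₀ hi₀).1
  set x₀ := u i₀
  let z : α → α →₀ ℚ := fun x => Finsupp.single x 1 - Finsupp.single x₀ 1
  -- All edge vectors of `F` are differences of vectors `z x`, so they live in dimension at most `#U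
  -- - 1`.
  set N := Submodule.span ℚ (((U.erase x₀).image z : Finset (α →₀ ℚ)) : Set (α →₀ ℚ)) with hN
  have hz : ∀ x ∈ U, z x ∈ N := by
    intro x hx
    by_cases hxx : x = x₀
    · simp [z, hxx]
    · exact Submodule.subset_span (by
        exact mem_coe.2 (mem_image_of_mem z (mem_erase.2 ⟨hxx, hx⟩)))
  have hwN : ∀ i : F, w i ∈ N := by
    intro i
    have := N.sub_mem (hz _ (hmem i i.2).1) (hz _ (hmem i i.2).2)
    simpa [z, hw] using this
  have hLI : LinearIndependent ℚ fun i : F => (⟨w i, hwN i⟩ : N) := by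
    apply LinearIndependent.of_comp N.subtype
    exact (hc j).mono (t := (F : Set ι)) fun i hi => hFj i hi
  have h1 := hLI.fintype_card_le_finrank
  have h2 : Module.finrank ℚ N ≤ #(U.erase x₀) :=
    (finrank_span_finset_le_card _).trans card_image_le
  have h3 := card_erase_add_one hx₀
  simp only [Fintype.card_coe] at h1
  change #F + 1 ≤ #U
  omega

/-! ### Hall and degeneracy colourings -/

open Finset in
/-- The sets of a family `p` in which any `F` sets cover at least `|F| / |κ|` points can be
coloured by `κ` so that every colour class satisfies Hall's condition. -/
theorem exists_coloring_hall {ι α κ : Type*} [Fintype κ] [DecidableEq α]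
    (p : ι → Finset α) (hp : ∀ F : Finset ι, #F ≤ Fintype.card κ * #(F.biUnion p)) :
    ∃ c : ι → κ, ∀ j, ∀ F : Finset ι, (∀ i ∈ F, c i = j) → #F ≤ #(F.biUnion p) := by
  classical
  -- Replace each point by `|κ|` copies; the copy chosen for a set is its colour.
  have hall : ∀ F : Finset ι, #F ≤ #(F.biUnion fun i => p i ×ˢ (univ : Finset κ)) := by
    intro F
    have : (F.biUnion fun i => p i ×ˢ (univ : Finset κ)) = F.biUnion p ×ˢ univ := by
      ext ⟨x, y⟩
      simp
    rw [this, card_product, card_univ, mul_comm]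
    exact hp F
  obtain ⟨f, hf, hfp⟩ := (all_card_le_biUnion_card_iff_exists_injective _).1 hall
  refine ⟨fun i => (f i).2, fun j F hF => ?_⟩
  refine card_le_card_of_injOn (fun i => (f i).1)
    (fun i hi => mem_biUnion.2 ⟨i, hi, (mem_product.1 (hfp i)).1⟩) ?_
  intro x hx y hy hxy
  exact hf (Prod.ext hxy ((hF x hx).trans (hF y hy).symm))

open Finset in
/-- A degenerate family of sets can be coloured so that at some vertex of every vertex set the sets
inside that vertex set have distinct colours. -/
theorem exists_coloring_degenerate {ι α κ : Type*} [Fintype ι] [Fintype κ]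
    (p : ι → Set α) (hp0 : ∀ i, (p i).Nonempty) (V : Finset α) [DecidableEq α]
    (hp : ∀ S ⊆ V, S.Nonempty →
      ∃ v ∈ S, {i | p i ⊆ S ∧ v ∈ p i}.ncard ≤ Fintype.card κ) :
    ∃ c : {i // p i ⊆ V} → κ, ∀ S ⊆ V, S.Nonempty → ∃ v ∈ S,
      ∀ x y : {i // p i ⊆ V}, p x ⊆ S → v ∈ p x → p y ⊆ S → v ∈ p y → c x = c y → x = y := by
  classical
  induction hn : #V generalizing V with
  | zero =>
    obtain rfl := card_eq_zero.1 hn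
    have : IsEmpty {i // p i ⊆ ((∅ : Finset α) : Set α)} :=
      ⟨fun x => by simpa [(hp0 x.1).ne_empty] using x.2⟩
    exact ⟨fun x => isEmptyElim x, fun S hS h => by simp [subset_empty.1 hS] at h⟩
  | succ n ih =>
    obtain ⟨v, hv, hdeg⟩ := hp V subset_rfl (card_pos.1 (by omega))
    obtain ⟨c, hc⟩ := ih (V.erase v) (fun S hS => hp S (hS.trans (erase_subset _ _)))
      (by rw [card_erase_of_mem hv, hn]; rfl)
    have hle : Fintype.card {i // p i ⊆ V ∧ v ∈ p i} ≤ Fintype.card κ := by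
      rw [← Nat.card_eq_fintype_card]
      exact hdeg
    -- Sets through `v` get distinct colours from `g`, so `v` serves every `S` containing it; other
    -- `S` are handled by induction.
    obtain ⟨g⟩ := Function.Embedding.nonempty_of_card_le hle
    have hsub : ∀ i, p i ⊆ V → v ∉ p i → p i ⊆ (V.erase v : Finset α) := by
      intro i hi hvi x hx
      exact mem_coe.2 (mem_erase.2 ⟨fun h => hvi (h ▸ hx), hi hx⟩)
    refine ⟨fun x => if h : v ∈ p x then g ⟨x, x.2, h⟩ else c ⟨x, hsub x x.2 h⟩, ?_⟩
    intro S hS hSne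
    by_cases hvS : v ∈ S
    · refine ⟨v, hvS, fun x y _ hx _ hy hxy => ?_⟩
      simp only [hx, hy, dif_pos] at hxy
      have := g.injective hxy
      simp only [Subtype.mk.injEq] at this
      exact Subtype.ext this
    · obtain ⟨u, hu, huc⟩ := hc S (subset_erase.2 ⟨hS, hvS⟩) hSne
      refine ⟨u, hu, fun x y hxS hx hyS hy hxy => ?_⟩
      have hvx : v ∉ p x := fun h => hvS (hxS h)
      have hvy : v ∉ p y := fun h => hvS (hyS h)
      simp only [hvx, hvy, dif_neg, not_false_eq_true] at hxy
      have := huc _ _ hxS hx hyS hy hxy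
      simp only [Subtype.mk.injEq] at this
      exact Subtype.ext this

open Finset in
/-- If a family of sets is `(k * D - 1)`-degenerate, then its vertices have a `k`-colouring whose
monochromatic sets form a `(D - 1)`-degenerate family. -/
theorem exists_vertex_coloring {ι α : Type*} [Finite ι] {k D : ℕ}
    (p : ι → Set α) (hp2 : ∀ i, (p i).Nontrivial) (V : Finset α)
    (hp : ∀ S ⊆ V, S.Nonempty → ∃ v ∈ S, {i | p i ⊆ S ∧ v ∈ p i}.ncard < k * D) (hk : 0 < k) :
    ∃ χ : α → Fin k, ∀ S ⊆ V, S.Nonempty → ∃ v ∈ S,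
      {i | p i ⊆ S ∧ v ∈ p i ∧ ∀ x ∈ p i, χ x = χ v}.ncard < D := by
  classical
  cases nonempty_fintype ι
  induction hn : #V generalizing V with
  | zero =>
    obtain rfl := card_eq_zero.1 hn
    exact ⟨fun _ => ⟨0, hk⟩, fun S hS h => by simp [subset_empty.1 hS] at h⟩
  | succ n ih =>
    obtain ⟨v, hv, hdeg⟩ := hp V subset_rfl (card_pos.1 (by omega))
    obtain ⟨χ, hχ⟩ := ih (V.erase v) (fun S hS => hp S (hS.trans (erase_subset _ _)))
      (by rw [card_erase_of_mem hv, hn]; rfl)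
    -- A set through `v` can be monochromatic only if `v` gets the colour of `t i`; pigeonhole finds
    -- a colour occurring fewer than `D` times.
    choose t ht htv using fun i => (hp2 i).exists_ne v
    have hpig : #{i | p i ⊆ V ∧ v ∈ p i} < #(univ : Finset (Fin k)) * D := by
      rw [card_univ, Fintype.card_fin, ← Set.ncard_coe_finset]
      simpa using hdeg
    obtain ⟨c, -, hc⟩ := exists_card_fiber_lt_of_card_lt_mul (f := fun i => χ (t i)) hpig
    refine ⟨Function.update χ v c, fun S hS hSne => ?_⟩
    by_cases hvS : v ∈ S
    · refine ⟨v, hvS, lt_of_le_of_lt ?_ hc⟩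
      rw [← Set.ncard_coe_finset]
      refine Set.ncard_le_ncard ?_ (Set.toFinite _)
      rintro i ⟨hiS, hvi, hi⟩
      have := hi _ (ht i)
      rw [Function.update_self, Function.update_of_ne (htv i)] at this
      simpa [hvi, this] using hiS.trans (coe_subset.2 hS)
    · obtain ⟨u, hu, huc⟩ := hχ S (subset_erase.2 ⟨hS, hvS⟩) hSne
      refine ⟨u, hu, lt_of_le_of_lt (Set.ncard_le_ncard ?_ (Set.toFinite _)) huc⟩
      rintro i ⟨hiS, hui, hi⟩
      refine ⟨hiS, hui, fun x hx => ?_⟩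
      have := hi x hx
      rwa [Function.update_of_ne (ne_of_mem_of_not_mem hu hvS),
        Function.update_of_ne (ne_of_mem_of_not_mem (mem_coe.1 (hiS hx)) hvS)] at this

open Finset in
/-- If the sum of the degrees is small then some degree is small. -/
theorem exists_degree_lt {ι α : Type*} [Finite ι] {k D : ℕ} (p : ι → Set α)
    (hpk : ∀ i, (p i).ncard = k) (hk : 0 < k) (S : Finset α)
    (h : {i | p i ⊆ S}.ncard < D * #S) :
    ∃ v ∈ S, {i | p i ⊆ S ∧ v ∈ p i}.ncard < k * D := by
  classical
  cases nonempty_fintype ι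
  have hdeg : ∀ v, {i | p i ⊆ S ∧ v ∈ p i}.ncard = #{i ∈ ({i | p i ⊆ S} : Finset ι) | v ∈ p i} := by
    intro v
    rw [← Set.ncard_coe_finset]
    simp
  have hin : ∀ i ∈ ({i | p i ⊆ S} : Finset ι), #{v ∈ S | v ∈ p i} = k := by
    intro i hi
    rw [← hpk i, ← Set.ncard_coe_finset]
    congr 1
    ext x
    simpa using fun hx => (mem_filter.1 hi).2 hx
  have hdc := sum_card_bipartiteAbove_eq_sum_card_bipartiteBelow (s := S)
    (t := ({i | p i ⊆ S} : Finset ι)) (fun v i => v ∈ p i)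
  simp only [bipartiteAbove, bipartiteBelow] at hdc
  rw [sum_congr rfl hin, sum_const, smul_eq_mul] at hdc
  have hcard : #{i | p i ⊆ S} < D * #S := by
    rw [← Set.ncard_coe_finset]
    simpa using h
  simp only [hdeg]
  apply exists_lt_of_sum_lt
  rw [hdc, sum_const, smul_eq_mul]
  calc _ < D * #S * k := Nat.mul_lt_mul_of_pos_right hcard hk
    _ = _ := by ring

/-! ### Densities, degeneracy and copies -/

namespace KGraph

/-- The subgraph of `G` with vertex set `S` and edge set `F`. -/
def restrict {k : ℕ} {α : Type*} (G : KGraph k α) (S : Set α) (F : Set (Set α))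
    (hS : S ⊆ G.vertexSet) (hF : F ⊆ G.edgeSet) (hFS : ∀ e ∈ F, e ⊆ S) : KGraph k α where
  vertexSet := S
  edgeSet := F
  subset_vertexSet_of_mem_edgeSet' := fun e he => hFS e he
  finite_vertexSet := G.finite_vertexSet.subset hS
  uniform := fun e he => G.uniform e (hF he)

theorem le_numVerts {k : ℕ} {α : Type*} {G : KGraph k α} (h : G.edgeSet.Nonempty) :
    k ≤ G.numVerts := by
  obtain ⟨e, he⟩ := h
  refine (G.uniform e he).symm.trans_le ?_
  exact Set.ncard_le_ncard (G.subset_vertexSet_of_mem_edgeSet' he) G.finite_vertexSet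

theorem edgeSet_sUnion_ncard_le {k : ℕ} {α : Type*} (G : KGraph k α) :
    (⋃₀ G.edgeSet).ncard ≤ G.numVerts :=
  Set.ncard_le_ncard (Set.sUnion_subset fun _ he => G.subset_vertexSet_of_mem_edgeSet' he)
    G.finite_vertexSet

theorem le_sUnion_ncard {k : ℕ} {α : Type*} (G : KGraph k α) {F : Set (Set α)}
    (hF : F ⊆ G.edgeSet) (h : F.Nonempty) : k ≤ (⋃₀ F).ncard := by
  have hsub : ⋃₀ F ⊆ G.vertexSet :=
    Set.sUnion_subset fun _ he => G.subset_vertexSet_of_mem_edgeSet' (hF he)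
  exact le_numVerts (G := G.restrict (⋃₀ F) F hsub hF fun _ => Set.subset_sUnion_of_mem) h

/-- Isolated vertices only lower `d₁`, so edge sets with the vertices they cover suffice. Since `k ≥
2`, the default value of `d₁` is avoided on nonempty edge sets. -/
theorem arboricity_le_iff {k : ℕ} (hk : 2 ≤ k) {α : Type*} (G : KGraph k α) (a : ℕ) :
    G.arboricity ≤ a ↔
      ∀ F ⊆ G.edgeSet, F.Nonempty → F.ncard + a ≤ a * (⋃₀ F).ncard := by
  constructor
  · intro h F hF hne
    have hsub : ⋃₀ F ⊆ G.vertexSet :=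
      Set.sUnion_subset fun _ he => G.subset_vertexSet_of_mem_edgeSet' (hF he)
    have hle := (G.isGreatest_arboricity.2 ⟨G.restrict (⋃₀ F) F hsub hF
      fun _ => Set.subset_sUnion_of_mem, ⟨hsub, hF⟩, rfl⟩).trans h
    have h2 : 2 ≤ (⋃₀ F).ncard := hk.trans (G.le_sUnion_ncard hF hne)
    have h2' : (2 : ℝ) ≤ ((⋃₀ F).ncard : ℝ) := by exact_mod_cast h2
    have hd : (F.ncard : ℝ) / ((⋃₀ F).ncard - 1) ≤ a := by
      simpa [d₁, numVerts, numEdges, restrict, h2] using hle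
    rw [div_le_iff₀ (by linarith)] at hd
    have : (F.ncard : ℝ) + a ≤ a * (⋃₀ F).ncard := by linarith
    exact_mod_cast this
  · intro h
    obtain ⟨J, hJ, hEq⟩ := G.isGreatest_arboricity.1
    rw [hEq, d₁]
    split_ifs with h2
    · rcases J.edgeSet.eq_empty_or_nonempty with h0 | h0
      · simp [numEdges, h0]
      · have h3 := h _ hJ.2 h0
        have h4 := Nat.mul_le_mul_left a J.edgeSet_sUnion_ncard_le
        have h5 : (J.numEdges : ℝ) + a ≤ a * J.numVerts := by exact_mod_cast h3.trans h4
        have h2' : (2 : ℝ) ≤ (J.numVerts : ℝ) := by exact_mod_cast h2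
        rw [div_le_iff₀ (by linarith)]
        linarith
    · positivity

theorem mDensity_le_iff {k : ℕ} (hk : 1 ≤ k) {α : Type*} (G : KGraph k α) (a : ℕ) :
    G.mDensity ≤ a ↔ ∀ F ⊆ G.edgeSet, F.ncard ≤ a * (⋃₀ F).ncard := by
  constructor
  · intro h F hF
    rcases F.eq_empty_or_nonempty with rfl | hne
    · simp
    have hsub : ⋃₀ F ⊆ G.vertexSet :=
      Set.sUnion_subset fun _ he => G.subset_vertexSet_of_mem_edgeSet' (hF he)
    have hle := (G.isGreatest_mDensity.2 ⟨G.restrict (⋃₀ F) F hsub hF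
      fun _ => Set.subset_sUnion_of_mem, ⟨hsub, hF⟩, rfl⟩).trans h
    have h1 : 1 ≤ (⋃₀ F).ncard := hk.trans (G.le_sUnion_ncard hF hne)
    have h1' : (1 : ℝ) ≤ ((⋃₀ F).ncard : ℝ) := by exact_mod_cast h1
    have hd : (F.ncard : ℝ) / (⋃₀ F).ncard ≤ a := by
      simpa [d, numVerts, numEdges, restrict, h1]
        using hle
    rw [div_le_iff₀ (by linarith)] at hd
    exact_mod_cast hd
  · intro h
    obtain ⟨J, hJ, hEq⟩ := G.isGreatest_mDensity.1
    rw [hEq, d]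
    split_ifs with h2
    · have h3 := h _ hJ.2
      have h4 := Nat.mul_le_mul_left a J.edgeSet_sUnion_ncard_le
      have h5 : (J.numEdges : ℝ) ≤ a * J.numVerts := by exact_mod_cast h3.trans h4
      have h2' : (1 : ℝ) ≤ (J.numVerts : ℝ) := by exact_mod_cast h2
      rwa [div_le_iff₀ (by linarith)]
    · positivity

theorem minDegree_le_degree {k : ℕ} {α : Type*} (G : KGraph k α) {v : α}
    (hv : v ∈ G.vertexSet) : G.minDegree ≤ G.degree v :=
  Nat.sInf_le ⟨v, hv, rfl⟩

theorem exists_degree_eq_minDegree {k : ℕ} {α : Type*} (G : KGraph k α)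
    (h : G.vertexSet.Nonempty) : ∃ v ∈ G.vertexSet, G.degree v = G.minDegree :=
  Nat.sInf_mem (h.image G.degree)

theorem minDegree_eq_zero {k : ℕ} {α : Type*} (G : KGraph k α)
    (h : G.vertexSet = ∅) : G.minDegree = 0 := by
  simp [minDegree, h]

/-- Among subgraphs with vertex set `S`, the induced one has the largest degrees. -/
theorem maxMinDegree_le_iff {k : ℕ} {α : Type*} (G : KGraph k α) (a : ℕ) :
    G.maxMinDegree ≤ a ↔ ∀ S ⊆ G.vertexSet, S.Nonempty →
      ∃ v ∈ S, {e | e ∈ G.edgeSet ∧ e ⊆ S ∧ v ∈ e}.ncard ≤ a := by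
  constructor
  · intro h S hS hne
    let J := G.restrict S {e | e ∈ G.edgeSet ∧ e ⊆ S} hS (fun e he => he.1) (fun e he => he.2)
    have hle := (G.isGreatest_maxMinDegree.2 ⟨J, ⟨hS, fun e he => he.1⟩, rfl⟩).trans h
    obtain ⟨v, hv, hvd⟩ := J.exists_degree_eq_minDegree hne
    refine ⟨v, hv, le_trans (le_of_eq ?_) (hvd.trans_le hle)⟩
    simp [degree, J, restrict, and_assoc]
  · intro h
    obtain ⟨J, hJ, hEq⟩ := G.isGreatest_maxMinDegree.1
    rw [hEq]
    rcases J.vertexSet.eq_empty_or_nonempty with h0 | h0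
    · rw [J.minDegree_eq_zero h0]
      exact Nat.zero_le _
    · obtain ⟨v, hv, hle⟩ := h _ hJ.1 h0
      refine (J.minDegree_le_degree hv).trans (le_trans (Set.ncard_le_ncard ?_ ?_) hle)
      · rintro e ⟨he, hve⟩
        exact ⟨hJ.2 he, J.subset_vertexSet_of_mem_edgeSet' he, hve⟩
      · exact G.finite_edgeSet.subset fun e he => he.1

/-- The image of `H` under an injection of its vertices. -/
def map {k : ℕ} {α β : Type*} (H : KGraph k β) (f : H.vertexSet → α)
    (hf : Function.Injective f) : KGraph k α where
  vertexSet := Set.range f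
  edgeSet := (fun e => f '' {v : H.vertexSet | (v : β) ∈ e}) '' H.edgeSet
  subset_vertexSet_of_mem_edgeSet' := by
    rintro _ ⟨e, -, rfl⟩
    exact Set.image_subset_range _ _
  finite_vertexSet := by
    have := H.finite_vertexSet.to_subtype
    exact Set.finite_range f
  uniform := by
    rintro _ ⟨e, he, rfl⟩
    rw [Set.ncard_image_of_injective _ hf, ← Set.ncard_image_of_injective _ Subtype.val_injective]
    refine Eq.trans ?_ (H.uniform e he)
    congr 1
    ext x
    simpa using fun hx => H.subset_vertexSet_of_mem_edgeSet' he hx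

section map
variable {k : ℕ} {α β : Type*} (H : KGraph k β) (f : H.vertexSet → α) (hf : Function.Injective f)

theorem injOn_edge_image (hf : Function.Injective f) :
    Set.InjOn (fun e => f '' {v : H.vertexSet | (v : β) ∈ e}) H.edgeSet := by
  intro e he e' he' h
  have h1 : {v : H.vertexSet | (v : β) ∈ e} = {v : H.vertexSet | (v : β) ∈ e'} :=
    hf.image_injective h
  ext x
  constructor
  · intro hx
    exact (Set.ext_iff.1 h1 ⟨x, H.subset_vertexSet_of_mem_edgeSet' he hx⟩).1 hx
  · intro hx
    exact (Set.ext_iff.1 h1 ⟨x, H.subset_vertexSet_of_mem_edgeSet' he' hx⟩).2 hx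

theorem numVerts_map : (H.map f hf).numVerts = H.numVerts := by
  change (Set.range f).ncard = _
  rw [← Set.image_univ, Set.ncard_image_of_injective _ hf, Set.ncard_univ]
  rfl

theorem numEdges_map : (H.map f hf).numEdges = H.numEdges :=
  (H.injOn_edge_image f hf).ncard_image

theorem degree_map (v : H.vertexSet) : (H.map f hf).degree (f v) = H.degree v := by
  have : {e | e ∈ (H.map f hf).edgeSet ∧ f v ∈ e} =
      (fun e => f '' {v : H.vertexSet | (v : β) ∈ e}) '' {e | e ∈ H.edgeSet ∧ (v : β) ∈ e} := by
    ext e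
    constructor
    · rintro ⟨⟨e', he', rfl⟩, hv⟩
      exact ⟨e', ⟨he', (hf.mem_set_image.1 hv :)⟩, rfl⟩
    · rintro ⟨e', ⟨he', hv⟩, rfl⟩
      exact ⟨⟨e', he', rfl⟩, hf.mem_set_image.2 hv⟩
  rw [degree, this, ((H.injOn_edge_image f hf).mono fun e he => he.1).ncard_image]
  rfl

theorem minDegree_map : (H.map f hf).minDegree = H.minDegree := by
  unfold minDegree
  congr 1
  ext n
  constructor
  · rintro ⟨_, ⟨v, rfl⟩, rfl⟩
    exact ⟨v, v.2, (H.degree_map f hf v).symm⟩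
  · rintro ⟨v, hv, rfl⟩
    exact ⟨f ⟨v, hv⟩, ⟨_, rfl⟩, H.degree_map f hf ⟨v, hv⟩⟩

end map

section ContainsCopy
variable {k : ℕ} {α β : Type*} {G : KGraph k α} {H : KGraph k β}

/-- Every subgraph of `H` has an isomorphic image in any graph containing a copy of `H`. -/
theorem ContainsCopy.exists_subgraph (h : G.ContainsCopy H) {J : KGraph k β}
    (hJ : J.IsSubgraph H) : ∃ J' : KGraph k α, J'.IsSubgraph G ∧ J'.numVerts = J.numVerts ∧
      J'.numEdges = J.numEdges ∧ J'.minDegree = J.minDegree := by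
  obtain ⟨f, hf, hfV, hfE⟩ := h
  have hg : Function.Injective (f ∘ Set.inclusion hJ.1) := hf.comp (Set.inclusion_injective _)
  refine ⟨J.map _ hg, ⟨?_, ?_⟩, J.numVerts_map _ hg, J.numEdges_map _ hg, J.minDegree_map _ hg⟩
  · rintro _ ⟨v, rfl⟩
    exact hfV _
  · rintro _ ⟨e, he, rfl⟩
    convert hfE e (hJ.2 he) using 1
    ext x
    constructor
    · rintro ⟨v, hv, rfl⟩
      exact ⟨Set.inclusion hJ.1 v, hv, rfl⟩
    · rintro ⟨v, hv, rfl⟩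
      exact ⟨⟨v, J.subset_vertexSet_of_mem_edgeSet' he hv⟩, hv, rfl⟩

theorem ContainsCopy.arboricity_le (h : G.ContainsCopy H) : H.arboricity ≤ G.arboricity := by
  obtain ⟨J, hJ, hEq⟩ := H.isGreatest_arboricity.1
  obtain ⟨J', hJ', hV, hE, -⟩ := h.exists_subgraph hJ
  exact G.isGreatest_arboricity.2 ⟨J', hJ', by rw [hEq, d₁, d₁, hV, hE]⟩

theorem ContainsCopy.mDensity_le (h : G.ContainsCopy H) : H.mDensity ≤ G.mDensity := by
  obtain ⟨J, hJ, hEq⟩ := H.isGreatest_mDensity.1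
  obtain ⟨J', hJ', hV, hE, -⟩ := h.exists_subgraph hJ
  exact G.isGreatest_mDensity.2 ⟨J', hJ', by rw [hEq, d, d, hV, hE]⟩

theorem ContainsCopy.maxMinDegree_le (h : G.ContainsCopy H) :
    H.maxMinDegree ≤ G.maxMinDegree := by
  obtain ⟨J, hJ, hEq⟩ := H.isGreatest_maxMinDegree.1
  obtain ⟨J', hJ', -, -, hδ⟩ := h.exists_subgraph hJ
  exact G.isGreatest_maxMinDegree.2 ⟨J', hJ', by rw [hEq, hδ]⟩

theorem ContainsCopy.edgeSet_nonempty (h : G.ContainsCopy H) (hH : H.edgeSet.Nonempty) :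
    G.edgeSet.Nonempty := by
  obtain ⟨f, -, -, hfE⟩ := h
  obtain ⟨e, he⟩ := hH
  exact ⟨_, hfE e he⟩

theorem ContainsCopy.weaklyColorable (h : G.ContainsCopy H) {t : ℕ} (hG : G.WeaklyColorable t) :
    H.WeaklyColorable t := by
  obtain ⟨f, -, hfV, hfE⟩ := h
  obtain ⟨c, hc⟩ := hG
  refine ⟨fun v => c ⟨f v, hfV v⟩, fun e he => ?_⟩
  obtain ⟨⟨_, _⟩, ⟨_, _⟩, ⟨u, hu, rfl⟩, ⟨v, hv, rfl⟩, huv⟩ := hc _ (hfE e he)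
  exact ⟨u, v, hu, hv, huv⟩

end ContainsCopy

theorem arboricity_pos {k : ℕ} (hk : 2 ≤ k) {α : Type*} {G : KGraph k α}
    (h : G.edgeSet.Nonempty) : 0 < G.arboricity := by
  by_contra hle
  have := (arboricity_le_iff hk G 0).1 (by simpa using hle) _ subset_rfl h
  have h0 := (Set.ncard_pos G.finite_edgeSet).2 h
  omega

theorem mDensity_pos {k : ℕ} (hk : 1 ≤ k) {α : Type*} {G : KGraph k α}
    (h : G.edgeSet.Nonempty) : 0 < G.mDensity := by
  by_contra hle
  have := (mDensity_le_iff hk G 0).1 (by simpa using hle) _ subset_rfl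
  have h0 := (Set.ncard_pos G.finite_edgeSet).2 h
  omega

theorem maxMinDegree_pos {k : ℕ} (hk : 1 ≤ k) {α : Type*} {G : KGraph k α}
    (h : G.edgeSet.Nonempty) : 0 < G.maxMinDegree := by
  by_contra hle
  obtain ⟨e, he⟩ := h
  obtain ⟨v, hv, hle⟩ := (G.maxMinDegree_le_iff 0).1 (not_lt.1 hle) e
    (G.subset_vertexSet_of_mem_edgeSet' he)
    (Set.nonempty_of_ncard_ne_zero (by rw [G.uniform e he]; omega))
  rw [Nat.le_zero, Set.ncard_eq_zero (G.finite_edgeSet.subset fun e he => he.1)] at hle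
  exact Set.eq_empty_iff_forall_notMem.1 hle e ⟨he, subset_rfl, hv⟩

end KGraph

/-! ### Splitting the edges of a `k`-graph -/

-- Merging step: colour `i` consists of the `a i` subcolours `⟨i, j⟩`, so a bound per subcolour adds
-- up.
open Finset in
theorem card_le_mul_of_sigma_coloring {ι : Type*} {r : ℕ} {a : Fin r → ℕ}
    (c : ι → Σ i, Fin (a i)) (i : Fin r) (F : Finset ι) (hF : ∀ e ∈ F, (c e).1 = i) (b : ℕ)
    (hb : ∀ j, #{e ∈ F | c e = j} ≤ b) : #F ≤ a i * b := by
  have h := card_le_mul_card_image_of_maps_to (s := F) (f := c)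
    (t := (univ : Finset (Fin (a i))).image (Sigma.mk (β := fun i => Fin (a i)) i)) (fun e he => by
      obtain rfl := hF e he
      exact mem_image_of_mem _ (mem_univ _)) b (fun j _ => hb j)
  have h2 : #((univ : Finset (Fin (a i))).image (Sigma.mk (β := fun i => Fin (a i)) i)) ≤ a i := by
    simpa using card_image_le (s := (univ : Finset (Fin (a i)))) (f := Sigma.mk (β := fun i => Fin (a i)) i)
  rw [mul_comm]
  exact h.trans (Nat.mul_le_mul_left b h2)

namespace KGraph

section
variable {k : ℕ} {α : Type*} (G : KGraph k α)

/-- An edge of `G` as a finset of vertices. -/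
noncomputable def edgeFinset (e : G.edgeSet) : Finset α :=
  (G.finite_vertexSet.subset (G.subset_vertexSet_of_mem_edgeSet' e.2)).toFinset

theorem coe_edgeFinset (e : G.edgeSet) : (G.edgeFinset e : Set α) = e :=
  Set.Finite.coe_toFinset _

open Finset in
theorem ncard_sUnion_image [DecidableEq α] (F : Finset G.edgeSet) :
    (⋃₀ (Subtype.val '' (F : Set G.edgeSet))).ncard = #(F.biUnion G.edgeFinset) := by
  rw [← Set.ncard_coe_finset, coe_biUnion, Set.sUnion_image]
  simp only [coe_edgeFinset]

open Finset in
theorem ncard_val_image (F : Finset G.edgeSet) :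
    (Subtype.val '' (F : Set G.edgeSet)).ncard = #F := by
  rw [Set.ncard_image_of_injective _ Subtype.val_injective, Set.ncard_coe_finset]

theorem exists_finset_val_image_eq {F : Set (Set α)} (hF : F ⊆ G.edgeSet) :
    ∃ F' : Finset G.edgeSet, Subtype.val '' (F' : Set G.edgeSet) = F := by
  have := G.finite_edgeSet.to_subtype
  refine ⟨(Set.toFinite (Subtype.val ⁻¹' F)).toFinset, ?_⟩
  rw [Set.Finite.coe_toFinset, Subtype.image_preimage_coe, Set.inter_eq_right]
  exact hF

open Finset in
theorem exists_colorClass_arboricity_le (hk : 2 ≤ k) {r : ℕ} (a : Fin r → ℕ)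
    (h : G.arboricity ≤ ((∑ i, a i : ℕ) : ℝ)) :
    ∃ c : G.edgeSet → Fin r, ∀ i, (G.colorClass c i).arboricity ≤ a i := by
  classical
  have := G.finite_edgeSet.fintype
  rw [arboricity_le_iff hk] at h
  have hcard : Fintype.card (Σ i, Fin (a i)) = ∑ i, a i := by simp
  obtain ⟨c, hc⟩ := exists_coloring_forests (κ := Σ i, Fin (a i)) G.edgeFinset (by
    intro F hF
    rw [hcard, ← ncard_sUnion_image, ← ncard_val_image]
    refine h _ ?_ (hF.to_set.image _)
    rintro _ ⟨e, -, rfl⟩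
    exact e.2)
  refine ⟨fun e => (c e).1, fun i => ?_⟩
  rw [arboricity_le_iff hk]
  intro F hF hne
  obtain ⟨F', rfl⟩ := G.exists_finset_val_image_eq (hF.trans fun e he => he.1)
  rw [ncard_val_image, ncard_sUnion_image]
  have hFc : ∀ e ∈ F', (c e).1 = i := fun e he => (hF ⟨e, he, rfl⟩).2
  have hb : ∀ j, #{e ∈ F' | c e = j} ≤ #(F'.biUnion G.edgeFinset) - 1 := by
    intro j
    rcases ({e ∈ F' | c e = j} : Finset _).eq_empty_or_nonempty with h0 | h0
    · simp [h0]
    · have h1 := hc j _ h0 (fun e he => (mem_filter.1 he).2)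
      have h2 := card_le_card (biUnion_subset_biUnion_of_subset_left G.edgeFinset
        (filter_subset (fun e => c e = j) F'))
      omega
  have h1 := card_le_mul_of_sigma_coloring c i F' hFc _ hb
  -- Needed because the bound for each forest uses truncated subtraction.
  have hpos : 1 ≤ #(F'.biUnion G.edgeFinset) := by
    obtain ⟨_, e, he, -⟩ := hne
    have h1 := hc (c e) {e} (by simp) (by simp)
    have h2 := card_le_card (subset_biUnion_of_mem G.edgeFinset he)
    simp only [card_singleton, singleton_biUnion] at h1
    omega
  obtain ⟨b, hb'⟩ := Nat.exists_eq_add_of_le hpos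
  rw [hb', add_tsub_cancel_left] at h1
  rw [hb', mul_add, mul_one]
  omega

open Finset in
theorem exists_colorClass_mDensity_le (hk : 1 ≤ k) {r : ℕ} (a : Fin r → ℕ)
    (h : G.mDensity ≤ ((∑ i, a i : ℕ) : ℝ)) :
    ∃ c : G.edgeSet → Fin r, ∀ i, (G.colorClass c i).mDensity ≤ a i := by
  classical
  rw [mDensity_le_iff hk] at h
  have hcard : Fintype.card (Σ i, Fin (a i)) = ∑ i, a i := by simp
  obtain ⟨c, hc⟩ := exists_coloring_hall (κ := Σ i, Fin (a i)) G.edgeFinset (by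
    intro F
    rw [hcard, ← ncard_sUnion_image, ← ncard_val_image]
    refine h _ ?_
    rintro _ ⟨e, -, rfl⟩
    exact e.2)
  refine ⟨fun e => (c e).1, fun i => ?_⟩
  rw [mDensity_le_iff hk]
  intro F hF
  obtain ⟨F', rfl⟩ := G.exists_finset_val_image_eq (hF.trans fun e he => he.1)
  rw [ncard_val_image, ncard_sUnion_image]
  refine card_le_mul_of_sigma_coloring c i F' (fun e he => (hF ⟨e, he, rfl⟩).2) _ fun j => ?_
  exact (hc j _ (fun e he => (mem_filter.1 he).2)).trans
    (card_le_card (biUnion_subset_biUnion_of_subset_left _ (filter_subset _ _)))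

theorem ncard_setOf_edge (P : Set α → Prop) :
    {e | e ∈ G.edgeSet ∧ P e}.ncard = {e : G.edgeSet | P e}.ncard := by
  rw [← Set.ncard_image_of_injective _ Subtype.val_injective]
  congr 1
  ext e
  simp [and_comm]

/-- At the vertex given by `exists_coloring_degenerate` the edges inside `S` have distinct
subcolours, and only `a i` of these belong to `i`. -/
theorem exists_colorClass_maxMinDegree_le (hk : 1 ≤ k) {r : ℕ} (a : Fin r → ℕ)
    (h : G.maxMinDegree ≤ ∑ i, a i) :
    ∃ c : G.edgeSet → Fin r, ∀ i, (G.colorClass c i).maxMinDegree ≤ a i := by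
  classical
  have := G.finite_edgeSet.fintype
  rw [maxMinDegree_le_iff] at h
  have hcard : Fintype.card (Σ i, Fin (a i)) = ∑ i, a i := by simp
  have hV : ∀ e : G.edgeSet, (e : Set α) ⊆ (G.finite_vertexSet.toFinset : Set α) := fun e => by
    rw [Set.Finite.coe_toFinset]
    exact G.subset_vertexSet_of_mem_edgeSet' e.2
  obtain ⟨c, hc⟩ := exists_coloring_degenerate (κ := Σ i, Fin (a i))
    (Subtype.val : G.edgeSet → Set α)
    (fun e => Set.nonempty_of_ncard_ne_zero (by rw [G.uniform e e.2]; omega))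
    G.finite_vertexSet.toFinset (by
      intro S hS hne
      obtain ⟨v, hv, hle⟩ := h S (by simpa using hS) hne
      refine ⟨v, hv, ?_⟩
      rw [hcard]
      rwa [G.ncard_setOf_edge fun e => e ⊆ S ∧ v ∈ e] at hle)
  refine ⟨fun e => (c ⟨e, hV e⟩).1, fun i => ?_⟩
  rw [maxMinDegree_le_iff]
  intro S hS hne
  lift S to Finset α using G.finite_vertexSet.subset hS
  obtain ⟨v, hv, hinj⟩ := hc S (by simpa [colorClass] using hS) hne
  refine ⟨v, hv, ?_⟩
  obtain ⟨F', hF'⟩ := G.exists_finset_val_image_eq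
    (F := {e | e ∈ (G.colorClass (fun e => (c ⟨e, hV e⟩).1) i).edgeSet ∧ e ⊆ S ∧ v ∈ e})
    (fun e he => he.1.1)
  have hmem : ∀ e ∈ F', (c ⟨e, hV e⟩).1 = i ∧ (e : Set α) ⊆ S ∧ v ∈ (e : Set α) := fun e he => by
    obtain ⟨⟨h1, h2⟩, h3⟩ := hF'.subset ⟨e, he, rfl⟩
    exact ⟨h2, h3⟩
  rw [← hF', ncard_val_image, ← mul_one (a i)]
  refine card_le_mul_of_sigma_coloring (fun e => c ⟨e, hV e⟩) i F' (fun e he => (hmem e he).1) 1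
    fun j => Finset.card_le_one.2 fun x hx y hy => ?_
  rw [Finset.mem_filter] at hx hy
  have hx' := hmem x hx.1
  have hy' := hmem y hy.1
  have := hinj ⟨x, hV x⟩ ⟨y, hV y⟩ hx'.2.1 hx'.2.2 hy'.2.1 hy'.2.2 (hx.2.trans hy.2.symm)
  exact congrArg Subtype.val this

/-- The average degree of an induced subgraph is `k` times its density, hence below `k * D`, as the
greedy vertex colouring requires. -/
theorem exists_weak_coloring_of_mDensity_lt (hk : 2 ≤ k) {D : ℕ} (h : G.mDensity < D) :
    ∃ χ : α → Fin k, ∀ S ⊆ G.vertexSet, S.Nonempty → ∃ v ∈ S,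
      {e | e ∈ G.edgeSet ∧ e ⊆ S ∧ v ∈ e ∧ ∀ x ∈ e, χ x = χ v}.ncard < D := by
  classical
  have := G.finite_edgeSet.to_subtype
  obtain ⟨χ, hχ⟩ := exists_vertex_coloring (k := k) (D := D) (Subtype.val : G.edgeSet → Set α)
    (fun e => Set.one_lt_ncard_iff_nontrivial_and_finite.1 (by rw [G.uniform e e.2]; omega) |>.1)
    G.finite_vertexSet.toFinset (by
      intro S hS hne
      refine exists_degree_lt (Subtype.val : G.edgeSet → Set α) (fun e => G.uniform e e.2) (by omega) S ?_
      have hS' : (S : Set α) ⊆ G.vertexSet := by simpa using hS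
      have hlt := (G.isGreatest_mDensity.2 ⟨G.restrict S {e | e ∈ G.edgeSet ∧ e ⊆ S} hS'
        (fun e he => he.1) (fun e he => he.2), ⟨hS', fun e he => he.1⟩, rfl⟩).trans_lt h
      have hpos : 0 < S.card := hne.card_pos
      have hpos' : (0 : ℝ) < S.card := by exact_mod_cast hpos
      have hlt' : (({e | e ∈ G.edgeSet ∧ e ⊆ S}.ncard : ℕ) : ℝ) / S.card < D := by
        simpa [d, numVerts, numEdges, restrict, hne.ne_empty, Nat.one_le_iff_ne_zero] using hlt
      rw [div_lt_iff₀ hpos', G.ncard_setOf_edge fun e => e ⊆ S] at hlt'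
      exact_mod_cast hlt') (by omega)
  refine ⟨χ, fun S hS hne => ?_⟩
  lift S to Finset α using G.finite_vertexSet.subset hS
  obtain ⟨v, hv, hlt⟩ := hχ S (by simpa using hS) hne
  refine ⟨v, hv, ?_⟩
  rwa [G.ncard_setOf_edge fun e => e ⊆ S ∧ v ∈ e ∧ ∀ x ∈ e, χ x = χ v]

/-- If `m(G) < D` then the edges of `G` can be coloured so that the first colour class is
`(D - 1)`-degenerate, the second is weakly `k`-colourable, and the others are empty. -/
theorem exists_colorClass_maxMinDegree_lt (hk : 2 ≤ k) {r D : ℕ} (h : G.mDensity < D)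
    {i₀ i₁ : Fin r} (hi : i₀ ≠ i₁) :
    ∃ c : G.edgeSet → Fin r, (G.colorClass c i₀).maxMinDegree < D ∧
      (G.colorClass c i₁).WeaklyColorable k ∧
      ∀ i, i ≠ i₀ → i ≠ i₁ → (G.colorClass c i).edgeSet = ∅ := by
  classical
  -- Makes `D - 1` a genuine predecessor; the empty subgraph shows `m(G) ≥ 0`.
  have hD : 0 < D := by
    have h0 : 0 ≤ G.mDensity :=
      G.isGreatest_mDensity.2 ⟨G.restrict ∅ ∅ (by simp) (by simp) (by simp), by
        simp [IsSubgraph, restrict], by simp [d, numVerts, restrict]⟩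
    exact_mod_cast h0.trans_lt h
  obtain ⟨χ, hχ⟩ := G.exists_weak_coloring_of_mDensity_lt hk h
  refine ⟨fun e => if ∀ x ∈ (e : Set α), ∀ y ∈ (e : Set α), χ x = χ y then i₀ else i₁,
    ?_, ⟨fun v => χ v, ?_⟩, ?_⟩
  · rw [← Nat.le_sub_one_iff_lt hD, maxMinDegree_le_iff]
    intro S hS hne
    obtain ⟨v, hv, hlt⟩ := hχ S hS hne
    refine ⟨v, hv, Nat.le_sub_one_of_lt (lt_of_le_of_lt (Set.ncard_le_ncard ?_
      (G.finite_edgeSet.subset fun e he => he.1)) hlt)⟩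
    rintro e ⟨⟨he, hc⟩, heS, hve⟩
    have hmono : ∀ x ∈ e, ∀ y ∈ e, χ x = χ y := by
      by_contra hn
      exact hi (by simpa [hn] using hc.symm)
    exact ⟨he, heS, hve, fun x hx => hmono x hx v hve⟩
  · rintro e ⟨he, hc⟩
    have hn : ¬ ∀ x ∈ e, ∀ y ∈ e, χ x = χ y := fun hmono => hi ((if_pos hmono).symm.trans hc)
    push Not at hn
    obtain ⟨x, hx, y, hy, hxy⟩ := hn
    have hsub := G.subset_vertexSet_of_mem_edgeSet' he
    exact ⟨⟨x, hsub hx⟩, ⟨y, hsub hy⟩, hx, hy, hxy⟩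
  · intro i h0 h1
    rw [Set.eq_empty_iff_forall_notMem]
    rintro e ⟨he, hc⟩
    dsimp only at hc
    split_ifs at hc
    · exact h0 hc.symm
    · exact h1 hc.symm

end

/-! ### Rounding and conclusion -/

theorem le_sum_toNat {r : ℕ} {x : ℝ} (z : Fin r → ℤ) (h : x ≤ ((∑ i, z i : ℤ) : ℝ)) :
    x ≤ ((∑ i, (z i).toNat : ℕ) : ℝ) := by
  refine h.trans ?_
  have : ∑ i, z i ≤ ((∑ i, (z i).toNat : ℕ) : ℤ) := by
    push_cast
    exact Finset.sum_le_sum fun i _ => Int.self_le_toNat (z i)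
  exact_mod_cast this

/-- A negative floor becomes `0`, which is still below `x`. Positivity of `x` will come from `H i`
having an edge. -/
theorem toNat_floor_sub_lt {x ε : ℝ} (hx : 0 < x) (hε : 0 < ε) : ((⌊x - ε⌋.toNat : ℕ) : ℝ) < x := by
  rcases le_total 0 ⌊x - ε⌋ with h | h
  · have h1 : ((⌊x - ε⌋.toNat : ℕ) : ℝ) = (⌊x - ε⌋ : ℝ) := by
      exact_mod_cast congrArg (Int.cast : ℤ → ℝ) (Int.toNat_of_nonneg h)
    have h2 := Int.floor_le (x - ε)
    linarith
  · rw [Int.toNat_of_nonpos h]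
    simpa using hx

end KGraph

open KGraph in
theorem lemma9p2 {k : ℕ} (hk : 2 ≤ k) {r : ℕ} {α : Type*} {β : Fin r → Type*}
    (G : KGraph k α) (H : (i : Fin r) → KGraph k (β i))
    (hH : ∀ i, (H i).edgeSet.Nonempty)
    (h : (∃ ε : ℝ, 0 < ε ∧
            G.arboricity ≤ ((∑ i : Fin r, ⌊(H i).arboricity - ε⌋ : ℤ) : ℝ)) ∨
         (∃ ε : ℝ, 0 < ε ∧
            G.mDensity ≤ ((∑ i : Fin r, ⌊(H i).mDensity - ε⌋ : ℤ) : ℝ)) ∨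
         ((G.maxMinDegree : ℤ) ≤ ∑ i : Fin r, (((H i).minDegree : ℤ) - 1)) ∨
         (∃ hr : 2 ≤ r,
            G.mDensity < ((H ⟨0, by omega⟩).maxMinDegree : ℝ) ∧
            k + 1 ≤ (H ⟨1, by omega⟩).weakChromaticNumber)) :
    ¬ G.Arrows H := by
  intro hG
  have hk1 : 1 ≤ k := by omega
  rcases h with ⟨ε, hε, h⟩ | ⟨ε, hε, h⟩ | h | ⟨hr, h1, h2⟩
  · obtain ⟨c, hc⟩ := G.exists_colorClass_arboricity_le hk _ (le_sum_toNat _ h)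
    obtain ⟨i, hi⟩ := hG c
    exact absurd (hi.arboricity_le.trans (hc i))
      (not_le.2 (toNat_floor_sub_lt (arboricity_pos hk (hH i)) hε))
  · obtain ⟨c, hc⟩ := G.exists_colorClass_mDensity_le hk1 _ (le_sum_toNat _ h)
    obtain ⟨i, hi⟩ := hG c
    exact absurd (hi.mDensity_le.trans (hc i))
      (not_le.2 (toNat_floor_sub_lt (mDensity_pos hk1 (hH i)) hε))
  -- Isolated vertices can make `minDegree` zero; the truncated bound `0` is then still beaten by
  -- `maxMinDegree_pos`.
  · obtain ⟨c, hc⟩ := G.exists_colorClass_maxMinDegree_le hk1 (fun i => (H i).minDegree - 1) (by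
      have h' : ∑ i : Fin r, (((H i).minDegree : ℤ) - 1) ≤
          ((∑ i, ((H i).minDegree - 1) : ℕ) : ℤ) := by
        push_cast
        exact Finset.sum_le_sum fun i _ => by omega
      exact_mod_cast h.trans h')
    obtain ⟨i, hi⟩ := hG c
    have h1 := hi.maxMinDegree_le.trans (hc i)
    have h2 := maxMinDegree_pos hk1 (hH i)
    have h3 := (H i).isGreatest_maxMinDegree.2 ⟨H i, ⟨subset_rfl, subset_rfl⟩, rfl⟩
    omega
  · have hne : (⟨0, by omega⟩ : Fin r) ≠ ⟨1, by omega⟩ := by simp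
    obtain ⟨c, hc0, hc1, hc⟩ := G.exists_colorClass_maxMinDegree_lt hk h1 hne
    obtain ⟨i, hi⟩ := hG c
    by_cases h0 : i = ⟨0, by omega⟩
    · subst h0
      exact absurd (hi.maxMinDegree_le) (not_le.2 hc0)
    by_cases h1' : i = ⟨1, by omega⟩
    · subst h1'
      have : (H ⟨1, by omega⟩).weakChromaticNumber ≤ k := Nat.sInf_le (hi.weaklyColorable hc1)
      omega
    · exact (hi.edgeSet_nonempty (hH i)).ne_empty (hc i h0 h1')
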